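/- Let $(\Omega,\mu)$ be a finite probability space, let $n \ge 0$ be an integer, and equip $\Omega^n$ with the product measure $\mu^n$. For $f:\Omega^n\to\mathbb{R}$, $S\subseteq[n]=\{1,\dots,n\}$ and $x\in\Omega^S$, let $f_{S\to x}:\Omega^{[n]\setminus S}\to\mathbb{R}$ be the restriction $f_{S\to x}(y)=f(x,y)$. For $0\le\rho\le 1$ let $T_\rho$ be the noise operator $T_\rho f(x)=\mathbb{E}_{y\sim N_\rho(x)}[f(y)]$, where $N_\rho(x)$ is obtained from $x$ by independently, for each coordinate $i$, leaving $x_i$ unchanged with probability $\rho$ and replacing it by a fresh sample from $\mu$ with probability $1-\rho$. All norms are $L^p$ norms with respect to the product measures $\mu^n$ and $\mu^{[n]\setminus S}$, and $\log$ is the natural logarithm. **Theorem.** Let $q\ge 2$ and $r\ge 1$ be real numbers, and let $f:\Omega^n\to\mathbb{R}$ satisfy $$\|f_{S\to x}\|_2\le r^{|S|}\,\|f\|_2\qquad\text{for all } S\subseteq[n] \text{ and all } x\in\Omega^S.$$ Then for every real $\rho$ with $0\le\rho\le\dfrac{\log q}{32\,r\,q}$, $$\|T_\rho f\|_q\le\|f\|_2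 .$$ -/

import Mathlib

open MeasureTheory

/-- The product space `(Ω^I, μ^I)` over a finite index set `I`. -/
noncomputable def productMeasure {Ω : Type*} [MeasurableSpace Ω] (μ : Measure Ω)
    (I : Type*) [Fintype I] : Measure (I → Ω) :=
  Measure.pi (fun _ : I => μ)

/-- The restriction `f_{S → x} : Ω^{[n] ∖ S} → ℝ`, `f_{S → x}(y) = f(x, y)`. -/
def restriction {Ω : Type*} {n : ℕ} (f : (Fin n → Ω) → ℝ) (S : Finset (Fin n))
    (x : {i // i ∈ S} → Ω) : ({i // i ∉ S} → Ω) → ℝ :=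
  fun y => f (fun i => if h : i ∈ S then x ⟨i, h⟩ else y ⟨i, h⟩)

/-- The law of `N_ρ(x)`: independently for every coordinate `i`, keep `x i` with probability `ρ`
and replace it by a fresh sample from `μ` with probability `1 - ρ` (for `0 ≤ ρ ≤ 1`). -/
noncomputable def noiseMeasure {Ω : Type*} [MeasurableSpace Ω] (μ : Measure Ω) {n : ℕ}
    (ρ : ℝ) (x : Fin n → Ω) : Measure (Fin n → Ω) :=
  Measure.pi (fun i =>
    ENNReal.ofReal ρ • Measure.dirac (x i) + ENNReal.ofReal (1 - ρ) • μ)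

/-- The noise operator `T_ρ f(x) = 𝔼_{y ∼ N_ρ(x)} f(y)`. -/
noncomputable def noiseOperator {Ω : Type*} [MeasurableSpace Ω] (μ : Measure Ω) {n : ℕ}
    (ρ : ℝ) (f : (Fin n → Ω) → ℝ) : (Fin n → Ω) → ℝ :=
  fun x => ∫ y, f y ∂(noiseMeasure μ ρ x)

/-! The L²-norms of restrictions drive an induction on coordinates, strengthened to Hilbert-valued
functions and to the bound `‖T_ρ f‖_q^q ≤ M^(q-2) ‖f‖_2^2` for `(r, M)`-global `f`; the theorem is
the case `M = ‖f‖_2`.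

Write `f = A + D_z` in the first coordinate, `A` the average over it and `D_z` of mean zero. The
one-variable inequality `sum_norm_add_smul_rpow_le` bounds the q-th moment by that of a vector of
norm squared `‖A‖² + 3/4 𝔼‖D_z‖²`, plus `s^(-q) 𝔼‖D_z‖^q`. The vector is again `(r, M)`-global
(`isGlobal_headVector`) and `D_z` is `(r, (1+r)M)`-global (`isGlobal_headDeriv`). With `s = 1 + r ≥
2`, induction charges the second term at most `1/4 M^(q-2) 𝔼‖D_z‖_2^2`, so the derivative energy is
counted `3/4 + 1/4 = 1` times. -/

/-! ### One-variable moment inequality in a Hilbert space. -/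

section OneVariable

theorem exp_le_one_add_add_sq_mul_exp_abs (x : ℝ) :
    Real.exp x ≤ 1 + x + x ^ 2 * Real.exp |x| := by
  rcases le_total 0 x with hx | hx
  · rw [abs_of_nonneg hx]
    have h : Real.exp x - 1 ≤ x * Real.exp x := by
      have h1 := Real.add_one_le_exp (-x)
      have h2 : Real.exp (-x) * Real.exp x = 1 := by rw [← Real.exp_add]; simp
      nlinarith [Real.exp_pos x]
    nlinarith
  · have h1 := Real.add_one_le_exp x
    have h2 : 1 ≤ Real.exp |x| := Real.one_le_exp (abs_nonneg x)
    have h : Real.exp x - 1 ≤ x * Real.exp x := by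
      have h1 := Real.add_one_le_exp (-x)
      have h2 : Real.exp (-x) * Real.exp x = 1 := by rw [← Real.exp_add]; simp
      nlinarith [Real.exp_pos x]
    nlinarith [mul_nonneg_of_nonpos_of_nonpos hx (by linarith : x - (Real.exp x - 1) ≤ 0),
      mul_nonneg (sq_nonneg x) (by linarith : 0 ≤ Real.exp |x| - 1)]

/-- With `m = q^(1/4)`, `log q ≤ 4m` makes the left side at most `16 m³`. -/
theorem sq_log_mul_exp_le {q : ℝ} (hq : 1 ≤ q) :
    Real.log q ^ 2 * Real.exp (Real.log q / 4) ≤ 16 * q := by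
  set m := Real.exp (Real.log q / 4) with hm
  have hm4 : m ^ 4 = q := by
    rw [hm, ← Real.exp_nat_mul]
    push_cast
    rw [mul_div_cancel₀ _ (by norm_num : (4 : ℝ) ≠ 0), Real.exp_log (by linarith)]
  have hL : 0 ≤ Real.log q := Real.log_nonneg hq
  have h1 : 1 ≤ m := Real.one_le_exp (by positivity)
  have h2 : Real.log q ≤ 4 * m := by
    have := Real.add_one_le_exp (Real.log q / 4)
    linarith
  calc Real.log q ^ 2 * m ≤ (4 * m) ^ 2 * m := by gcongr
    _ = 16 * (m ^ 3 * 1) := by ring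
    _ ≤ 16 * (m ^ 3 * m) := by gcongr
    _ = 16 * q := by rw [← hm4]; ring

/-- The scalar inequality behind `norm_add_smul_rpow_le`, for `‖a‖ = 1`, `β = ‖b‖`
and `u = ⟪a, κ b⟫`. -/
theorem one_add_rpow_half_le {q κ β u : ℝ} (hq : 2 ≤ q) (hκ0 : 0 ≤ κ)
    (hκ : κ ≤ Real.log q / (16 * q)) (hβ : 0 ≤ β) (hu : |u| ≤ κ * β)
    (hw : 0 ≤ 1 + 2 * u + (κ * β) ^ 2) :
    (1 + 2 * u + (κ * β) ^ 2) ^ (q / 2) ≤ 1 + q * u + 3 * q / 2 * β ^ 2 + β ^ q := by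
  have hq0 : 0 < q := by linarith
  have hL0 : 0 ≤ Real.log q := Real.log_nonneg (by linarith)
  have hqκ : q * κ ≤ Real.log q / 16 := by
    calc q * κ ≤ q * (Real.log q / (16 * q)) := by gcongr
      _ = Real.log q / 16 := by field_simp
  have hκ16 : κ ≤ 1 / 16 := by
    have := Real.log_le_sub_one_of_pos hq0
    by_contra! h
    nlinarith
  obtain ⟨hu1, hu2⟩ := abs_le.mp hu
  -- For `β ≥ 2` the term `β^q` alone dominates, since `1 + κβ ≤ β`. For `β ≤ 2` a second-order
  -- expansion of the exponential suffices.
  rcases le_total 2 β with h2 | h2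
  · have h3 : 1 + 2 * u + (κ * β) ^ 2 ≤ β ^ 2 := by
      have h4 : 0 ≤ κ * β := mul_nonneg hκ0 hβ
      have h5 : 1 + κ * β ≤ β := by nlinarith
      calc _ ≤ (1 + κ * β) ^ 2 := by linarith
        _ ≤ β ^ 2 := by gcongr
    have h4 : (1 + 2 * u + (κ * β) ^ 2) ^ (q / 2) ≤ β ^ q := by
      calc _ ≤ (β ^ 2) ^ (q / 2) := Real.rpow_le_rpow hw h3 (by positivity)
        _ = β ^ q := by
          rw [← Real.rpow_natCast, ← Real.rpow_mul hβ]; congr 1; push_cast; ring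
    have h5 : 0 ≤ q * (u + 3 / 2 * β ^ 2) := by
      apply mul_nonneg hq0.le
      nlinarith
    linarith
  · set x := q * u + q * (κ * β) ^ 2 / 2 with hx
    have h1 : (1 + 2 * u + (κ * β) ^ 2) ^ (q / 2) ≤ Real.exp x := by
      calc _ ≤ (Real.exp (2 * u + (κ * β) ^ 2)) ^ (q / 2) := by
            apply Real.rpow_le_rpow hw _ (by positivity)
            linarith [Real.add_one_le_exp (2 * u + (κ * β) ^ 2)]
        _ = Real.exp x := by rw [← Real.exp_mul]; congr 1; rw [hx]; ring
    have hκβ : 0 ≤ κ * β := mul_nonneg hκ0 hβ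
    have hκβ' : κ * β ≤ 1 / 8 := by nlinarith
    have hxabs : |x| ≤ Real.log q / 8 * β := by
      have h3 : |x| ≤ q * (κ * β) + q * (κ * β) ^ 2 / 2 := by
        rw [abs_le, hx]
        constructor
        · have : 0 ≤ q * (u + κ * β) := mul_nonneg hq0.le (by linarith)
          nlinarith [mul_nonneg hq0.le (sq_nonneg (κ * β))]
        · have : 0 ≤ q * (κ * β - u) := mul_nonneg hq0.le (by linarith)
          linarith
      have h4 : q * κ * β ≤ Real.log q / 16 * β := by gcongr
      have h5 : q * (κ * β) ^ 2 ≤ q * (κ * β) := by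
        apply mul_le_mul_of_nonneg_left _ hq0.le
        nlinarith
      have h6 : 0 ≤ Real.log q * β := mul_nonneg hL0 hβ
      linarith
    -- This keeps `exp |x|` below `q^(1/4)`, so that the quadratic error is only linear in `q`.
    have hx4 : |x| ≤ Real.log q / 4 := hxabs.trans (by nlinarith)
    have hx2 : x ^ 2 ≤ (Real.log q / 8 * β) ^ 2 := by
      rw [← sq_abs x]; gcongr
    have h6 : x ^ 2 * Real.exp |x| ≤ q / 4 * β ^ 2 := by
      calc x ^ 2 * Real.exp |x|
          ≤ (Real.log q / 8 * β) ^ 2 * Real.exp (Real.log q / 4) := by gcongr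
        _ = (Real.log q ^ 2 * Real.exp (Real.log q / 4)) * (β ^ 2 / 64) := by ring
        _ ≤ 16 * q * (β ^ 2 / 64) :=
            mul_le_mul_of_nonneg_right (sq_log_mul_exp_le (by linarith)) (by positivity)
        _ = q / 4 * β ^ 2 := by ring
    have h7 : q * (κ * β) ^ 2 ≤ q * β ^ 2 := by
      gcongr
      exact mul_le_of_le_one_left hβ (by linarith)
    have h8 := exp_le_one_add_add_sq_mul_exp_abs x
    have h9 : 0 ≤ β ^ q := Real.rpow_nonneg hβ q
    have h10 : 0 ≤ q * β ^ 2 := by positivity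
    linarith

variable {H : Type*} [NormedAddCommGroup H] [InnerProductSpace ℝ H]

/-- For `a ≠ 0`, dividing by `‖a‖^q` reduces this to the scalar inequality. -/
theorem norm_add_smul_rpow_le {q κ : ℝ} (hq : 2 ≤ q) (hκ0 : 0 ≤ κ)
    (hκ : κ ≤ Real.log q / (16 * q)) (a b : H) :
    ‖a + κ • b‖ ^ q ≤ ‖a‖ ^ q + q * κ * ‖a‖ ^ (q - 2) * inner ℝ a b +
      3 * q / 2 * ‖a‖ ^ (q - 2) * ‖b‖ ^ 2 + ‖b‖ ^ q := by
  have hq0 : 0 < q := by linarith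
  rcases eq_or_ne a 0 with rfl | ha
  · have hκ1 : κ ≤ 1 := by
      have := Real.log_le_sub_one_of_pos hq0
      refine hκ.trans ?_
      rw [div_le_one (by positivity)]
      linarith
    have h1 : ‖(0 : H) + κ • b‖ ^ q ≤ ‖b‖ ^ q := by
      apply Real.rpow_le_rpow (norm_nonneg _) _ hq0.le
      rw [zero_add, norm_smul, Real.norm_of_nonneg hκ0]
      exact mul_le_of_le_one_left (norm_nonneg b) hκ1
    have h2 : 0 ≤ 3 * q / 2 * ‖(0 : H)‖ ^ (q - 2) * ‖b‖ ^ 2 := by positivity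
    have h3 : 0 ≤ ‖(0 : H)‖ ^ q := by positivity
    rw [inner_zero_left]
    linarith
  · have hA : 0 < ‖a‖ := norm_pos_iff.mpr ha
    set A := ‖a‖ with hAdef
    set u := κ * inner ℝ a b / A ^ 2 with hu
    have hsq : ‖a + κ • b‖ ^ 2 = A ^ 2 * (1 + 2 * u + (κ * (‖b‖ / A)) ^ 2) := by
      rw [norm_add_sq_real, inner_smul_right, norm_smul, Real.norm_of_nonneg hκ0, hu, ← hAdef]
      field_simp
    have hw : 0 ≤ 1 + 2 * u + (κ * (‖b‖ / A)) ^ 2 := by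
      by_contra! h
      nlinarith [sq_nonneg ‖a + κ • b‖, pow_pos hA 2]
    have huabs : |u| ≤ κ * (‖b‖ / A) := by
      rw [hu, abs_div, abs_mul, abs_of_nonneg hκ0, abs_of_pos (pow_pos hA 2),
        div_le_iff₀ (pow_pos hA 2)]
      calc κ * |inner ℝ a b| ≤ κ * (A * ‖b‖) := by
            gcongr; exact abs_real_inner_le_norm a b
        _ = κ * (‖b‖ / A) * A ^ 2 := by field_simp
    have key := one_add_rpow_half_le hq hκ0 hκ (div_nonneg (norm_nonneg b) hA.le) huabs hw
    have hpow : ∀ t : ℝ, 0 ≤ t → (t ^ 2) ^ (q / 2) = t ^ q := fun t ht => by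
      rw [← Real.rpow_natCast, ← Real.rpow_mul ht]; congr 1; push_cast; ring
    have hAq : A ^ q = A ^ (q - 2) * A ^ 2 := by
      rw [← Real.rpow_natCast A 2, ← Real.rpow_add hA]; congr 1; push_cast; ring
    have hbq : A ^ q * (‖b‖ / A) ^ q = ‖b‖ ^ q := by
      rw [← Real.mul_rpow hA.le (by positivity), mul_div_cancel₀ _ hA.ne']
    calc ‖a + κ • b‖ ^ q
        = A ^ q * (1 + 2 * u + (κ * (‖b‖ / A)) ^ 2) ^ (q / 2) := by
          rw [← hpow _ (norm_nonneg _), hsq, Real.mul_rpow (by positivity) hw, hpow _ hA.le]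
      _ ≤ A ^ q * (1 + q * u + 3 * q / 2 * (‖b‖ / A) ^ 2 + (‖b‖ / A) ^ q) := by gcongr
      _ = A ^ q + A ^ q * (q * u + 3 * q / 2 * (‖b‖ / A) ^ 2) + A ^ q * (‖b‖ / A) ^ q := by ring
      _ = _ := by rw [hbq, hAq, hu]; field_simp; ring

/-- Bernoulli's inequality, made homogeneous. -/
theorem rpow_add_mul_le_add_rpow {A X p : ℝ} (hp : 1 ≤ p) (hA : 0 ≤ A) (hX : 0 ≤ X) :
    A ^ p + p * A ^ (p - 1) * X ≤ (A + X) ^ p := by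
  rcases hA.eq_or_lt with rfl | hA
  · rcases hp.eq_or_lt with rfl | hp
    · simp
    · rw [Real.zero_rpow (by linarith), Real.zero_rpow (by linarith)]
      simpa using Real.rpow_nonneg hX p
  · have h := one_add_mul_self_le_rpow_one_add (s := X / A)
      (by linarith [div_nonneg hX hA.le]) hp
    have h1 : A ^ p = A ^ (p - 1) * A := by
      rw [← Real.rpow_add_one hA.ne']; congr 1; ring
    calc A ^ p + p * A ^ (p - 1) * X = A ^ p * (1 + p * (X / A)) := by
          rw [h1]; field_simp
      _ ≤ A ^ p * (1 + X / A) ^ p := by gcongr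
      _ = (A + X) ^ p := by
          rw [← Real.mul_rpow hA.le (by positivity)]; congr 1; field_simp

/-- The linear term averages to zero, and Bernoulli with exponent `q/2` absorbs the quadratic one
into a power. -/
theorem sum_norm_add_smul_rpow_le {Ω : Type*} [Fintype Ω] {w : Ω → ℝ} (hw : ∀ z, 0 ≤ w z)
    (hw1 : ∑ z, w z = 1) {q s ρ : ℝ} (hq : 2 ≤ q) (hs : 2 ≤ s) (hρ0 : 0 ≤ ρ)
    (hρ : ρ ≤ Real.log q / (16 * s * q)) (a : H) (b : Ω → H) (hb : ∑ z, w z • b z = 0) :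
    ∑ z, w z * ‖a + ρ • b z‖ ^ q ≤
      (‖a‖ ^ 2 + 3 / 4 * ∑ z, w z * ‖b z‖ ^ 2) ^ (q / 2) +
        (s ^ q)⁻¹ * ∑ z, w z * ‖b z‖ ^ q := by
  have hq0 : 0 < q := by linarith
  have hs0 : 0 < s := by linarith
  have hκ : ρ * s ≤ Real.log q / (16 * q) := by
    calc ρ * s ≤ Real.log q / (16 * s * q) * s := by gcongr
      _ = Real.log q / (16 * q) := by field_simp
  have hpt : ∀ z, ‖a + ρ • b z‖ ^ q ≤ ‖a‖ ^ q + q * ρ * ‖a‖ ^ (q - 2) * inner ℝ a (b z) +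
      q / 2 * ‖a‖ ^ (q - 2) * (3 / 4 * ‖b z‖ ^ 2) + (s ^ q)⁻¹ * ‖b z‖ ^ q := fun z => by
    -- Writing `ρ b = (ρ s)(b / s)` yields the factor `s^(-q)`; `s ≥ 2` shrinks the quadratic term
    -- by `1/4`, whence the constant `3/4`.
    have h := norm_add_smul_rpow_le hq (mul_nonneg hρ0 hs0.le) hκ a (s⁻¹ • b z)
    rw [smul_smul, mul_assoc ρ, mul_inv_cancel₀ hs0.ne', mul_one, inner_smul_right, norm_smul,
      norm_inv, Real.norm_of_nonneg hs0.le, Real.mul_rpow (by positivity) (norm_nonneg _),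
      Real.inv_rpow hs0.le] at h
    have h1 : (s⁻¹ * ‖b z‖) ^ 2 ≤ 1 / 4 * ‖b z‖ ^ 2 := by
      rw [mul_pow]
      gcongr
      rw [inv_pow, one_div]
      apply inv_anti₀ (by norm_num)
      nlinarith
    have h2 : q * (ρ * s) * ‖a‖ ^ (q - 2) * (s⁻¹ * inner ℝ a (b z)) =
        q * ρ * ‖a‖ ^ (q - 2) * inner ℝ a (b z) := by field_simp
    have h3 : 3 * q / 2 * ‖a‖ ^ (q - 2) * (s⁻¹ * ‖b z‖) ^ 2 ≤
        3 * q / 2 * ‖a‖ ^ (q - 2) * (1 / 4 * ‖b z‖ ^ 2) := by gcongr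
    linarith
  have hin : ∑ z, w z * inner ℝ a (b z) = 0 := by
    simp_rw [← inner_smul_right]
    rw [← inner_sum, hb, inner_zero_right]
  have hpow : ∀ (t : ℝ) (p : ℝ), 0 ≤ t → (t ^ 2) ^ p = t ^ (2 * p) := fun t p ht => by
    rw [← Real.rpow_natCast, ← Real.rpow_mul ht]; push_cast; rfl
  have hB := rpow_add_mul_le_add_rpow (A := ‖a‖ ^ 2) (X := 3 / 4 * ∑ z, w z * ‖b z‖ ^ 2)
    (p := q / 2) (by linarith) (by positivity)
    (mul_nonneg (by norm_num)
      (Finset.sum_nonneg fun z _ => mul_nonneg (hw z) (by positivity)))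
  rw [hpow _ _ (norm_nonneg a), hpow _ _ (norm_nonneg a), show 2 * (q / 2) = q by ring,
    show 2 * (q / 2 - 1) = q - 2 by ring] at hB
  calc ∑ z, w z * ‖a + ρ • b z‖ ^ q
      ≤ ∑ z, w z * (‖a‖ ^ q + q * ρ * ‖a‖ ^ (q - 2) * inner ℝ a (b z) +
      q / 2 * ‖a‖ ^ (q - 2) * (3 / 4 * ‖b z‖ ^ 2) + (s ^ q)⁻¹ * ‖b z‖ ^ q) :=
        Finset.sum_le_sum fun z _ => mul_le_mul_of_nonneg_left (hpt z) (hw z)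
    _ = ∑ z, (‖a‖ ^ q * w z + q * ρ * ‖a‖ ^ (q - 2) * (w z * inner ℝ a (b z)) +
      q / 2 * ‖a‖ ^ (q - 2) * (3 / 4 * (w z * ‖b z‖ ^ 2)) +
      (s ^ q)⁻¹ * (w z * ‖b z‖ ^ q)) := Finset.sum_congr rfl fun z _ => by ring
    _ = ‖a‖ ^ q + q / 2 * ‖a‖ ^ (q - 2) * (3 / 4 * ∑ z, w z * ‖b z‖ ^ 2) +
      (s ^ q)⁻¹ * ∑ z, w z * ‖b z‖ ^ q := by
        simp only [Finset.sum_add_distrib, ← Finset.mul_sum]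
        rw [hw1, hin]; ring
    _ ≤ _ := by gcongr

end OneVariable

/-! ### Induction on the number of coordinates. -/

section Tensorization

universe u

/-- The probability of the point `x` under the product of the weights `w`. -/
noncomputable def piWeight {Ω : Type*} {I : Type*} [Fintype I] (w : Ω → ℝ) (x : I → Ω) : ℝ :=
  ∏ i, w (x i)

/-- The transition probability from `x` to `y` of the noise operator on a single coordinate. -/
noncomputable def noiseKernel {Ω : Type*} (w : Ω → ℝ) (ρ : ℝ) (x y : Ω) : ℝ :=
  open Classical in ρ * (if x = y then 1 else 0) + (1 - ρ) * w y

/-- The noise operator on functions with values in a real vector space. -/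
noncomputable def noiseSum {Ω : Type*} [Fintype Ω] {H : Type*} [AddCommMonoid H] [Module ℝ H]
    (w : Ω → ℝ) (ρ : ℝ) {n : ℕ} (f : (Fin n → Ω) → H) (x : Fin n → Ω) : H :=
  ∑ y, (∏ i, noiseKernel w ρ (x i) (y i)) • f y

theorem sum_fin_succ_pi {Ω : Type*} [Fintype Ω] {M : Type*} [AddCommMonoid M] {n : ℕ}
    (g : (Fin (n + 1) → Ω) → M) :
    ∑ v, g v = ∑ z, ∑ x : Fin n → Ω, g (Fin.cons z x) := by
  rw [← Fintype.sum_prod_type' (f := fun z (x : Fin n → Ω) => g (Fin.cons z x))]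
  exact (Fintype.sum_equiv (Fin.consEquiv fun _ => Ω) _ _ fun _ => rfl).symm

theorem piWeight_nonneg {Ω I : Type*} [Fintype I] {w : Ω → ℝ} (hw : ∀ z, 0 ≤ w z) (x : I → Ω) :
    0 ≤ piWeight w x :=
  Finset.prod_nonneg fun i _ => hw (x i)

theorem sum_piWeight_fin_succ {Ω : Type*} [Fintype Ω] (w : Ω → ℝ) {n : ℕ}
    (g : (Fin (n + 1) → Ω) → ℝ) :
    ∑ v, piWeight w v * g v =
      ∑ z, w z * ∑ x : Fin n → Ω, piWeight w x * g (Fin.cons z x) := by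
  rw [sum_fin_succ_pi]
  refine Finset.sum_congr rfl fun z _ => ?_
  rw [Finset.mul_sum]
  refine Finset.sum_congr rfl fun x _ => ?_
  simp [piWeight, Fin.prod_univ_succ, mul_assoc]

theorem sum_piWeight_fin_succ' {Ω : Type*} [Fintype Ω] (w : Ω → ℝ) {n : ℕ}
    (g : (Fin (n + 1) → Ω) → ℝ) :
    ∑ v, piWeight w v * g v =
      ∑ x : Fin n → Ω, piWeight w x * ∑ z, w z * g (Fin.cons z x) := by
  rw [sum_piWeight_fin_succ]
  simp_rw [Finset.mul_sum]
  rw [Finset.sum_comm]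
  exact Finset.sum_congr rfl fun x _ => Finset.sum_congr rfl fun z _ => by ring

section NoiseSum

variable {Ω : Type*} [Fintype Ω] {H : Type*} [AddCommGroup H] [Module ℝ H]
  (w : Ω → ℝ) (ρ : ℝ) {n : ℕ}

theorem noiseSum_sub (f g : (Fin n → Ω) → H) (x : Fin n → Ω) :
    noiseSum w ρ (fun y => f y - g y) x = noiseSum w ρ f x - noiseSum w ρ g x := by
  simp [noiseSum, smul_sub, Finset.sum_sub_distrib]

theorem noiseSum_const_smul (c : ℝ) (f : (Fin n → Ω) → H) (x : Fin n → Ω) :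
    noiseSum w ρ (fun y => c • f y) x = c • noiseSum w ρ f x := by
  simp only [noiseSum, Finset.smul_sum]
  exact Finset.sum_congr rfl fun y _ => smul_comm _ _ _

theorem noiseSum_sum {ι : Type*} (s : Finset ι) (f : ι → (Fin n → Ω) → H) (x : Fin n → Ω) :
    noiseSum w ρ (fun y => ∑ j ∈ s, f j y) x = ∑ j ∈ s, noiseSum w ρ (f j) x := by
  simp only [noiseSum, Finset.smul_sum]
  exact Finset.sum_comm

theorem noiseSum_cons (f : (Fin (n + 1) → Ω) → H) (z : Ω) (x : Fin n → Ω) :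
    noiseSum w ρ f (Fin.cons z x) =
      ρ • noiseSum w ρ (fun y => f (Fin.cons z y)) x +
        (1 - ρ) • ∑ z', w z' • noiseSum w ρ (fun y => f (Fin.cons z' y)) x := by
  classical
  have h : noiseSum w ρ f (Fin.cons z x) =
      ∑ z', noiseKernel w ρ z z' • noiseSum w ρ (fun y => f (Fin.cons z' y)) x := by
    simp only [noiseSum, sum_fin_succ_pi, Fin.prod_univ_succ, Fin.cons_zero, Fin.cons_succ,
      mul_smul, Finset.smul_sum]
  rw [h]
  simp only [noiseKernel, add_smul, Finset.sum_add_distrib, mul_smul, ← Finset.smul_sum, ite_smul,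
    one_smul, zero_smul, Finset.sum_ite_eq, Finset.mem_univ, if_true]

theorem noiseSum_toLp {ι : Type*} [Fintype ι] (f : (Fin n → Ω) → ι → H) (x : Fin n → Ω) (j : ι) :
    noiseSum w ρ (fun y => WithLp.toLp 2 (f y)) x j = noiseSum w ρ (fun y => f y j) x := by
  simp [noiseSum, WithLp.ofLp_sum, Finset.sum_apply]

end NoiseSum

theorem sum_mul_norm_sub_sq {Ω : Type*} [Fintype Ω] {H : Type*} [NormedAddCommGroup H]
    [InnerProductSpace ℝ H] {w : Ω → ℝ} (hw1 : ∑ z, w z = 1) (φ : Ω → H) :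
    ‖∑ z, w z • φ z‖ ^ 2 + ∑ z, w z * ‖φ z - ∑ z, w z • φ z‖ ^ 2 =
      ∑ z, w z * ‖φ z‖ ^ 2 := by
  set A := ∑ z, w z • φ z with hA
  have h : ∑ z, w z * inner ℝ (φ z) A = ‖A‖ ^ 2 := by
    rw [← real_inner_self_eq_norm_sq]
    nth_rw 2 [hA]
    rw [sum_inner]
    simp_rw [real_inner_smul_left]
  have h2 : ∑ z, w z * ‖φ z - A‖ ^ 2 =
      ∑ z, (w z * ‖φ z‖ ^ 2 - 2 * (w z * inner ℝ (φ z) A) + ‖A‖ ^ 2 * w z) :=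
    Finset.sum_congr rfl fun z _ => by rw [norm_sub_sq_real]; ring
  rw [h2, Finset.sum_add_distrib, Finset.sum_sub_distrib, ← Finset.mul_sum, ← Finset.mul_sum, h,
    hw1]
  ring

/-- The weights are tuned to `‖a‖ ≤ rM`, `‖b‖ ≤ M`, where the right side becomes exactly `((1 + r)
M)²`. -/
theorem norm_sub_sq_le_mul_add_mul {H : Type*} [NormedAddCommGroup H] [InnerProductSpace ℝ H]
    {r : ℝ} (hr : 0 < r) (a b : H) :
    ‖a - b‖ ^ 2 ≤ (1 + r⁻¹) * ‖a‖ ^ 2 + (1 + r) * ‖b‖ ^ 2 := by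
  have h1 : ‖a - b‖ ≤ ‖a‖ + ‖b‖ := norm_sub_le a b
  have h2 : 0 ≤ r⁻¹ * (‖a‖ - r * ‖b‖) ^ 2 := by positivity
  have h3 : r⁻¹ * (‖a‖ - r * ‖b‖) ^ 2 = r⁻¹ * ‖a‖ ^ 2 - 2 * (‖a‖ * ‖b‖) + r * ‖b‖ ^ 2 := by
    field_simp
    ring
  nlinarith [norm_nonneg (a - b), norm_nonneg a, norm_nonneg b]

/-- A function is `(r, M)`-global if fixing any set `S` of coordinates yields a function of
`L²`-norm at most `r ^ |S| * M`. -/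
def IsGlobal {Ω : Type*} [Fintype Ω] {H : Type*} [NormedAddCommGroup H] (w : Ω → ℝ) (r M : ℝ)
    {n : ℕ} (f : (Fin n → Ω) → H) : Prop :=
  ∀ (S : Finset (Fin n)) (x : Fin n → Ω),
    ∑ y, piWeight w y * ‖f (S.piecewise x y)‖ ^ 2 ≤ (r ^ S.card * M) ^ 2

section IsGlobal

variable {Ω : Type*} [Fintype Ω] {H : Type*} [NormedAddCommGroup H]
  {w : Ω → ℝ} {r M : ℝ} {n : ℕ} {f : (Fin (n + 1) → Ω) → H}

theorem IsGlobal.sum_cons_le (hf : IsGlobal w r M f) (S : Finset (Fin n)) (x : Fin n → Ω) :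
    ∑ z, w z * ∑ y, piWeight w y * ‖f (Fin.cons z (S.piecewise x y))‖ ^ 2 ≤
      (r ^ S.card * M) ^ 2 := by
  rcases isEmpty_or_nonempty Ω with hΩ | ⟨⟨z₀⟩⟩
  · simpa using sq_nonneg (r ^ S.card * M)
  -- Coordinate 0 stays free, so the choice of `z₀` is irrelevant.
  · have h := hf (S.map (Fin.succEmb n)) (Fin.cons z₀ x)
    rw [Finset.card_map, sum_piWeight_fin_succ] at h
    refine le_of_eq_of_le ?_ h
    refine Finset.sum_congr rfl fun z _ => ?_
    congr 1
    refine Finset.sum_congr rfl fun y _ => ?_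
    congr 4
    ext i
    refine Fin.cases ?_ (fun i => ?_) i <;> simp [Finset.piecewise]

theorem IsGlobal.cons_le (hw1 : ∑ z, w z = 1) (hf : IsGlobal w r M f) (z : Ω)
    (S : Finset (Fin n)) (x : Fin n → Ω) :
    ∑ y, piWeight w y * ‖f (Fin.cons z (S.piecewise x y))‖ ^ 2 ≤
      (r ^ (S.card + 1) * M) ^ 2 := by
  have h := hf (insert 0 (S.map (Fin.succEmb n))) (Fin.cons z x)
  rw [Finset.card_insert_of_notMem (by simp), Finset.card_map, sum_piWeight_fin_succ] at h
  refine le_of_eq_of_le ?_ h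
  have h2 : ∀ z' : Ω, ∀ y : Fin n → Ω,
      (insert 0 (S.map (Fin.succEmb n))).piecewise (Fin.cons z x : Fin (n + 1) → Ω)
        (Fin.cons z' y) = Fin.cons z (S.piecewise x y) := fun z' y => by
    ext i
    refine Fin.cases ?_ (fun i => ?_) i <;> simp [Finset.piecewise]
  simp_rw [h2]
  rw [← Finset.sum_mul, hw1, one_mul]

end IsGlobal

section Induction

variable {Ω : Type u} [Fintype Ω] {H : Type u} [NormedAddCommGroup H] [InnerProductSpace ℝ H]
  {w : Ω → ℝ} {r M : ℝ} {n : ℕ}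

/-- The average of `f` over the first coordinate. -/
noncomputable def headAverage (w : Ω → ℝ) (f : (Fin (n + 1) → Ω) → H) (x : Fin n → Ω) : H :=
  ∑ z, w z • f (Fin.cons z x)

/-- The derivative of `f` in the direction `z` of the first coordinate. -/
noncomputable def headDeriv (w : Ω → ℝ) (f : (Fin (n + 1) → Ω) → H) (z : Ω) (x : Fin n → Ω) : H :=
  f (Fin.cons z x) - headAverage w f x

/-- The function of the remaining coordinates that collects the average of `f` and its scaled
derivatives with respect to the first coordinate. -/
noncomputable def headVector (w : Ω → ℝ) (f : (Fin (n + 1) → Ω) → H) (x : Fin n → Ω) :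
    PiLp 2 (fun _ : Option Ω => H) :=
  WithLp.toLp 2 fun o =>
    o.elim (headAverage w f x) fun z => √(3 / 4 * w z) • headDeriv w f z x

theorem norm_headAverage_sq_add (hw1 : ∑ z, w z = 1) (f : (Fin (n + 1) → Ω) → H)
    (x : Fin n → Ω) :
    ‖headAverage w f x‖ ^ 2 + ∑ z, w z * ‖headDeriv w f z x‖ ^ 2 =
      ∑ z, w z * ‖f (Fin.cons z x)‖ ^ 2 :=
  sum_mul_norm_sub_sq hw1 fun z => f (Fin.cons z x)

theorem norm_headVector_sq (hw : ∀ z, 0 ≤ w z) (f : (Fin (n + 1) → Ω) → H) (x : Fin n → Ω) :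
    ‖headVector w f x‖ ^ 2 =
      ‖headAverage w f x‖ ^ 2 + 3 / 4 * ∑ z, w z * ‖headDeriv w f z x‖ ^ 2 := by
  rw [PiLp.norm_sq_eq_of_L2, Fintype.sum_option, Finset.mul_sum]
  simp only [headVector, Option.elim]
  congr 1
  refine Finset.sum_congr rfl fun z _ => ?_
  have := hw z
  rw [norm_smul, mul_pow, Real.norm_of_nonneg (Real.sqrt_nonneg _), Real.sq_sqrt (by positivity)]
  ring

theorem norm_noiseSum_headVector_sq (hw : ∀ z, 0 ≤ w z) (ρ : ℝ) (f : (Fin (n + 1) → Ω) → H)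
    (x : Fin n → Ω) :
    ‖noiseSum w ρ (headVector w f) x‖ ^ 2 = ‖noiseSum w ρ (headAverage w f) x‖ ^ 2 +
      3 / 4 * ∑ z, w z * ‖noiseSum w ρ (headDeriv w f z) x‖ ^ 2 := by
  rw [PiLp.norm_sq_eq_of_L2, Fintype.sum_option, Finset.mul_sum]
  unfold headVector
  simp only [noiseSum_toLp, Option.elim]
  congr 1
  refine Finset.sum_congr rfl fun z _ => ?_
  have := hw z
  rw [noiseSum_const_smul, norm_smul, mul_pow, Real.norm_of_nonneg (Real.sqrt_nonneg _),
    Real.sq_sqrt (by positivity)]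
  ring

/-- Pointwise, the squared norm is at most the mean square of `f` over the first coordinate, because
`3/4 ≤ 1`. -/
theorem isGlobal_headVector (hw : ∀ z, 0 ≤ w z) (hw1 : ∑ z, w z = 1)
    {f : (Fin (n + 1) → Ω) → H} (hf : IsGlobal w r M f) :
    IsGlobal w r M (headVector w f) := fun S x => by
  refine le_trans ?_ (hf.sum_cons_le S x)
  simp_rw [Finset.mul_sum]
  rw [Finset.sum_comm]
  refine Finset.sum_le_sum fun y _ => ?_
  have h : ‖headVector w f (S.piecewise x y)‖ ^ 2 ≤
      ∑ z, w z * ‖f (Fin.cons z (S.piecewise x y))‖ ^ 2 := by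
    rw [norm_headVector_sq hw, ← norm_headAverage_sq_add hw1]
    have : 0 ≤ ∑ z, w z * ‖headDeriv w f z (S.piecewise x y)‖ ^ 2 :=
      Finset.sum_nonneg fun z _ => mul_nonneg (hw z) (by positivity)
    linarith
  refine (mul_le_mul_of_nonneg_left h (piWeight_nonneg hw y)).trans_eq ?_
  rw [Finset.mul_sum]
  exact Finset.sum_congr rfl fun z _ => by ring

theorem isGlobal_headDeriv (hw : ∀ z, 0 ≤ w z) (hw1 : ∑ z, w z = 1) (hr : 1 ≤ r)
    {f : (Fin (n + 1) → Ω) → H} (hf : IsGlobal w r M f) (z : Ω) :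
    IsGlobal w r ((1 + r) * M) (headDeriv w f z) := fun S x => by
  have hr0 : 0 < r := by linarith
  have h1 := hf.cons_le hw1 z S x
  have h2 : ∑ y, piWeight w y * ‖headAverage w f (S.piecewise x y)‖ ^ 2 ≤
      (r ^ S.card * M) ^ 2 := by
    refine le_trans ?_ (isGlobal_headVector hw hw1 hf S x)
    refine Finset.sum_le_sum fun y _ => mul_le_mul_of_nonneg_left ?_ (piWeight_nonneg hw y)
    rw [norm_headVector_sq hw]
    have : 0 ≤ ∑ z, w z * ‖headDeriv w f z (S.piecewise x y)‖ ^ 2 :=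
      Finset.sum_nonneg fun z _ => mul_nonneg (hw z) (by positivity)
    linarith
  calc ∑ y, piWeight w y * ‖headDeriv w f z (S.piecewise x y)‖ ^ 2
      ≤ ∑ y, piWeight w y * ((1 + r⁻¹) * ‖f (Fin.cons z (S.piecewise x y))‖ ^ 2 +
          (1 + r) * ‖headAverage w f (S.piecewise x y)‖ ^ 2) :=
        Finset.sum_le_sum fun y _ => mul_le_mul_of_nonneg_left
          (norm_sub_sq_le_mul_add_mul hr0 _ _) (piWeight_nonneg hw y)
    _ = (1 + r⁻¹) * ∑ y, piWeight w y * ‖f (Fin.cons z (S.piecewise x y))‖ ^ 2 +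
        (1 + r) * ∑ y, piWeight w y * ‖headAverage w f (S.piecewise x y)‖ ^ 2 := by
      rw [Finset.mul_sum, Finset.mul_sum, ← Finset.sum_add_distrib]
      exact Finset.sum_congr rfl fun y _ => by ring
    _ ≤ (1 + r⁻¹) * (r ^ (S.card + 1) * M) ^ 2 + (1 + r) * (r ^ S.card * M) ^ 2 := by gcongr
    _ = (r ^ S.card * ((1 + r) * M)) ^ 2 := by
      field_simp
      ring

/-- Noise on the first coordinate fixes the average and scales the derivative by `ρ`; noise on the
others is linear, so the derivatives keep mean zero. -/
theorem norm_noiseSum_cons_rpow_le (hw : ∀ z, 0 ≤ w z) (hw1 : ∑ z, w z = 1) {q s ρ : ℝ}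
    (hq : 2 ≤ q) (hs : 2 ≤ s) (hρ0 : 0 ≤ ρ) (hρ : ρ ≤ Real.log q / (16 * s * q))
    (f : (Fin (n + 1) → Ω) → H) (x : Fin n → Ω) :
    ∑ z, w z * ‖noiseSum w ρ f (Fin.cons z x)‖ ^ q ≤
      ‖noiseSum w ρ (headVector w f) x‖ ^ q +
        (s ^ q)⁻¹ * ∑ z, w z * ‖noiseSum w ρ (headDeriv w f z) x‖ ^ q := by
  have hA : noiseSum w ρ (headAverage w f) x =
      ∑ z, w z • noiseSum w ρ (fun y => f (Fin.cons z y)) x := by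
    unfold headAverage
    rw [noiseSum_sum]
    simp_rw [noiseSum_const_smul]
  have hD : ∀ z, noiseSum w ρ (headDeriv w f z) x =
      noiseSum w ρ (fun y => f (Fin.cons z y)) x - noiseSum w ρ (headAverage w f) x := fun z =>
    noiseSum_sub _ _ _ _ _
  have h := sum_norm_add_smul_rpow_le hw hw1 hq hs hρ0 hρ (noiseSum w ρ (headAverage w f) x)
    (fun z => noiseSum w ρ (headDeriv w f z) x) (by
      simp_rw [hD, smul_sub]
      rw [Finset.sum_sub_distrib, ← hA, ← Finset.sum_smul, hw1, one_smul, sub_self])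
  rw [← norm_noiseSum_headVector_sq hw, ← Real.rpow_natCast, ← Real.rpow_mul (norm_nonneg _),
    show ((2 : ℕ) : ℝ) * (q / 2) = q by push_cast; ring] at h
  refine le_of_eq_of_le ?_ h
  refine Finset.sum_congr rfl fun z _ => ?_
  rw [noiseSum_cons, ← hA, hD]
  congr 3
  rw [smul_sub, sub_smul, one_smul]
  abel

end Induction

/-- `H` and `M` are quantified inside the induction because `headVector` enlarges the space and
`headDeriv` the bound. A common universe for `Ω` and `H` keeps the enlarged space admissible. -/
theorem sum_norm_noiseSum_rpow_le_of_isGlobal {Ω : Type u} [Fintype Ω] {w : Ω → ℝ}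
    (hw : ∀ z, 0 ≤ w z) (hw1 : ∑ z, w z = 1) {q r ρ : ℝ} (hq : 2 ≤ q) (hr : 1 ≤ r)
    (hρ0 : 0 ≤ ρ) (hρ : ρ ≤ Real.log q / (16 * (1 + r) * q)) (n : ℕ) :
    ∀ {H : Type u} [NormedAddCommGroup H] [InnerProductSpace ℝ H] {M : ℝ} (_ : 0 ≤ M)
      {f : (Fin n → Ω) → H} (_ : IsGlobal w r M f),
      ∑ x, piWeight w x * ‖noiseSum w ρ f x‖ ^ q ≤
        M ^ (q - 2) * ∑ x, piWeight w x * ‖f x‖ ^ 2 := by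
  induction n with
  | zero =>
    intro H _ _ M hM f hf
    have h := hf ∅ default
    simp only [piWeight, noiseSum, Finset.univ_unique, Finset.sum_singleton, Finset.univ_eq_empty,
      Finset.prod_empty, one_mul, one_smul, Finset.card_empty, pow_zero,
      Finset.piecewise_empty] at h ⊢
    have hfM : ‖f default‖ ≤ M := le_of_sq_le_sq h hM
    calc ‖f default‖ ^ q = ‖f default‖ ^ (q - 2) * ‖f default‖ ^ 2 := by
          rw [← Real.rpow_natCast _ 2, ← Real.rpow_add_of_nonneg (norm_nonneg _) (by linarith)
            (by norm_num)]
          congr 1; push_cast; ring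
      _ ≤ M ^ (q - 2) * ‖f default‖ ^ 2 := by
          gcongr
  | succ n ih =>
    intro H _ _ M hM f hf
    set s := 1 + r with hs
    have hs2 : 2 ≤ s := by linarith
    have hs0 : 0 < s := by linarith
    set V := ∑ x, piWeight w x * ‖headAverage w f x‖ ^ 2 with hV
    set D : Ω → ℝ := fun z => ∑ x, piWeight w x * ‖headDeriv w f z x‖ ^ 2 with hD
    have hDsum : ∑ x, piWeight w x * ∑ z, w z * ‖headDeriv w f z x‖ ^ 2 = ∑ z, w z * D z := by
      simp_rw [hD, Finset.mul_sum]
      rw [Finset.sum_comm]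
      exact Finset.sum_congr rfl fun z _ => Finset.sum_congr rfl fun x _ => by ring
    have hDnonneg : 0 ≤ ∑ z, w z * D z := Finset.sum_nonneg fun z _ => mul_nonneg (hw z) <|
      Finset.sum_nonneg fun x _ => mul_nonneg (piWeight_nonneg hw x) (by positivity)
    have hf2 : ∑ x, piWeight w x * ‖f x‖ ^ 2 = V + ∑ z, w z * D z := by
      rw [sum_piWeight_fin_succ', ← hDsum, hV, ← Finset.sum_add_distrib]
      refine Finset.sum_congr rfl fun x _ => ?_
      rw [← norm_headAverage_sq_add hw1]
      ring
    have hvec : ∑ x, piWeight w x * ‖headVector w f x‖ ^ 2 = V + 3 / 4 * ∑ z, w z * D z := by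
      rw [← hDsum, hV, Finset.mul_sum, ← Finset.sum_add_distrib]
      refine Finset.sum_congr rfl fun x _ => ?_
      rw [norm_headVector_sq hw]
      ring
    have ih1 := ih hM (isGlobal_headVector hw hw1 hf)
    have ih2 : ∀ z, _ := fun z => ih (mul_nonneg hs0.le hM) (isGlobal_headDeriv hw hw1 hr hf z)
    have hconst : (s ^ q)⁻¹ * (s * M) ^ (q - 2) ≤ 1 / 4 * M ^ (q - 2) := by
      have h1 : (s ^ q)⁻¹ * s ^ (q - 2) = (s ^ 2)⁻¹ := by
        rw [← Real.rpow_neg hs0.le, ← Real.rpow_add hs0, ← Real.rpow_natCast, ← Real.rpow_neg hs0.le]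
        congr 1; push_cast; ring
      rw [Real.mul_rpow hs0.le hM, ← mul_assoc, h1, one_div]
      gcongr
      nlinarith
    calc ∑ v, piWeight w v * ‖noiseSum w ρ f v‖ ^ q
        = ∑ x, piWeight w x * ∑ z, w z * ‖noiseSum w ρ f (Fin.cons z x)‖ ^ q :=
          sum_piWeight_fin_succ' _ _
      _ ≤ ∑ x, piWeight w x * (‖noiseSum w ρ (headVector w f) x‖ ^ q +
          (s ^ q)⁻¹ * ∑ z, w z * ‖noiseSum w ρ (headDeriv w f z) x‖ ^ q) :=
          Finset.sum_le_sum fun x _ => mul_le_mul_of_nonneg_left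
            (norm_noiseSum_cons_rpow_le hw hw1 hq hs2 hρ0 hρ f x) (piWeight_nonneg hw x)
      _ = ∑ x, piWeight w x * ‖noiseSum w ρ (headVector w f) x‖ ^ q +
          (s ^ q)⁻¹ * ∑ z, w z * ∑ x, piWeight w x * ‖noiseSum w ρ (headDeriv w f z) x‖ ^ q := by
          simp_rw [mul_add, Finset.sum_add_distrib, Finset.mul_sum]
          congr 1
          rw [Finset.sum_comm]
          exact Finset.sum_congr rfl fun z _ => Finset.sum_congr rfl fun x _ => by ring
      _ ≤ M ^ (q - 2) * (V + 3 / 4 * ∑ z, w z * D z) +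
          (s ^ q)⁻¹ * ∑ z, w z * ((s * M) ^ (q - 2) * D z) := by
          rw [← hvec]
          gcongr with z
          · exact hw z
          · exact ih2 z
      _ = M ^ (q - 2) * (V + 3 / 4 * ∑ z, w z * D z) +
          ((s ^ q)⁻¹ * (s * M) ^ (q - 2)) * ∑ z, w z * D z := by
          congr 1
          rw [Finset.mul_sum, Finset.mul_sum]
          exact Finset.sum_congr rfl fun z _ => by ring
      _ ≤ M ^ (q - 2) * (V + 3 / 4 * ∑ z, w z * D z) +
          (1 / 4 * M ^ (q - 2)) * ∑ z, w z * D z := by gcongr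
      _ = M ^ (q - 2) * ∑ x, piWeight w x * ‖f x‖ ^ 2 := by rw [hf2]; ring

end Tensorization

/-! ### From finite sums to measures and `eLpNorm`. -/

section ProductMeasure

universe u

theorem sum_abs_noiseSum_rpow_le_of_isGlobal {Ω : Type u} [Fintype Ω] {w : Ω → ℝ}
    (hw : ∀ z, 0 ≤ w z) (hw1 : ∑ z, w z = 1) {q r ρ : ℝ} (hq : 2 ≤ q) (hr : 1 ≤ r)
    (hρ0 : 0 ≤ ρ) (hρ : ρ ≤ Real.log q / (16 * (1 + r) * q)) {n : ℕ} {M : ℝ} (hM : 0 ≤ M)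
    {f : (Fin n → Ω) → ℝ} (hf : IsGlobal w r M f) :
    ∑ x, piWeight w x * |noiseSum w ρ f x| ^ q ≤
      M ^ (q - 2) * ∑ x, piWeight w x * f x ^ 2 := by
  -- A one-dimensional copy of `ℝ` in the universe of `Ω`.
  have hnorm : ∀ v : PiLp 2 (fun _ : PUnit.{u + 1} => ℝ), ‖v‖ = |v PUnit.unit| := fun v => by
    rw [← sq_eq_sq₀ (norm_nonneg _) (abs_nonneg _), PiLp.norm_sq_eq_of_L2]
    simp
  have key := sum_norm_noiseSum_rpow_le_of_isGlobal hw hw1 hq hr hρ0 hρ n hM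
    (f := fun x => (WithLp.toLp 2 fun _ => f x : PiLp 2 (fun _ : PUnit.{u + 1} => ℝ)))
    (fun S x => by simpa [hnorm] using hf S x)
  simpa only [hnorm, noiseSum_toLp, sq_abs] using key

theorem measureReal_pi_singleton {Ω I : Type*} [Fintype I] [MeasurableSpace Ω]
    (ν : I → Measure Ω) [∀ i, IsFiniteMeasure (ν i)] (x : I → Ω) :
    (Measure.pi ν).real {x} = ∏ i, (ν i).real {x i} := by
  simp [measureReal_def, Measure.pi_singleton, ENNReal.toReal_prod]

variable {Ω : Type u} [Fintype Ω] [MeasurableSpace Ω] [MeasurableSingletonClass Ω]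
  (μ : Measure Ω) [IsProbabilityMeasure μ]

theorem sum_measureReal_singleton_eq_one : ∑ z, μ.real {z} = 1 := by
  simp [sum_measureReal_singleton]

theorem eLpNorm_productMeasure {I : Type*} [Fintype I] [DecidableEq I] {p : ℝ} (hp : 0 < p)
    (g : (I → Ω) → ℝ) :
    eLpNorm g (ENNReal.ofReal p) (productMeasure μ I) =
      ENNReal.ofReal ((∑ x, piWeight (fun z => μ.real {z}) x * ‖g x‖ ^ p) ^ p⁻¹) := by
  unfold productMeasure
  rw [MemLp.eLpNorm_eq_integral_rpow_norm (by simpa using hp) ENNReal.ofReal_ne_top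
    MemLp.of_discrete, ENNReal.toReal_ofReal hp.le, integral_fintype Integrable.of_finite]
  simp only [measureReal_pi_singleton, piWeight, smul_eq_mul]

theorem eLpNorm_two_productMeasure {I : Type*} [Fintype I] [DecidableEq I] (g : (I → Ω) → ℝ) :
    eLpNorm g 2 (productMeasure μ I) =
      ENNReal.ofReal √(∑ x, piWeight (fun z => μ.real {z}) x * g x ^ 2) := by
  have h := eLpNorm_productMeasure μ (I := I) (p := 2) (by norm_num) g
  rw [show ENNReal.ofReal 2 = 2 by simp] at h
  rw [h, Real.sqrt_eq_rpow]
  norm_num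

/-- The coordinates of `y` in `S` do not affect the integrand, and their weights sum to 1. -/
theorem sum_piWeight_piecewise (n : ℕ) (f : (Fin n → Ω) → ℝ) (S : Finset (Fin n))
    (x : Fin n → Ω) :
    ∑ y, piWeight (fun z => μ.real {z}) y * f (S.piecewise x y) ^ 2 =
      ∑ y, piWeight (fun z => μ.real {z}) y * restriction f S (fun i => x i) y ^ 2 := by
  classical
  rw [Fintype.sum_equiv (Equiv.piEquivPiSubtypeProd (fun i => i ∈ S) fun _ => Ω) _
    (fun v => (piWeight (fun z => μ.real {z}) v.1 * piWeight (fun z => μ.real {z}) v.2) *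
      restriction f S (fun i => x i) v.2 ^ 2), Fintype.sum_prod_type]
  · simp_rw [mul_assoc, ← Finset.mul_sum]
    rw [← Finset.sum_mul]
    have h : ∑ v : {i // i ∈ S} → Ω, piWeight (fun z => μ.real {z}) v = 1 := by
      unfold piWeight
      rw [← Fintype.prod_sum fun (_ : {i // i ∈ S}) z => μ.real {z}]
      simp
    rw [h, one_mul]
  · intro y
    congr 1
    simp only [piWeight, Equiv.piEquivPiSubtypeProd_apply]
    convert (Fintype.prod_subtype_mul_prod_subtype (fun i => i ∈ S) fun i => μ.real {y i}).symm

theorem noiseOperator_eq_noiseSum {ρ : ℝ} (hρ0 : 0 ≤ ρ) (hρ1 : ρ ≤ 1) {n : ℕ}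
    (f : (Fin n → Ω) → ℝ) (x : Fin n → Ω) :
    noiseOperator μ ρ f x = noiseSum (fun z => μ.real {z}) ρ f x := by
  have hfin : ∀ z, IsFiniteMeasure
      (ENNReal.ofReal ρ • Measure.dirac z + ENNReal.ofReal (1 - ρ) • μ) := fun z => by
    constructor
    simp
  have hreal : ∀ z y, (ENNReal.ofReal ρ • Measure.dirac z + ENNReal.ofReal (1 - ρ) • μ).real {y} =
      noiseKernel (fun z => μ.real {z}) ρ z y := fun z y => by
    classical
    have h1 : ENNReal.ofReal (1 - ρ) * μ {y} ≠ ⊤ :=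
      ENNReal.mul_ne_top ENNReal.ofReal_ne_top (measure_ne_top μ _)
    have h2 : ENNReal.ofReal ρ * Measure.dirac z {y} ≠ ⊤ :=
      ENNReal.mul_ne_top ENNReal.ofReal_ne_top (measure_ne_top _ _)
    simp only [measureReal_def, Measure.add_apply, Measure.smul_apply, smul_eq_mul, noiseKernel]
    rw [ENNReal.toReal_add h2 h1, ENNReal.toReal_mul, ENNReal.toReal_mul,
      ENNReal.toReal_ofReal hρ0, ENNReal.toReal_ofReal (sub_nonneg.mpr hρ1),
      Measure.dirac_apply' _ (measurableSet_singleton y)]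
    by_cases h : z = y <;> simp [h]
  classical
  unfold noiseOperator noiseMeasure noiseSum
  rw [integral_fintype Integrable.of_finite]
  simp only [measureReal_pi_singleton, hreal]

end ProductMeasure

theorem mainTheorem1 {Ω : Type*} [Fintype Ω] [MeasurableSpace Ω] [MeasurableSingletonClass Ω]
    (μ : Measure Ω) [IsProbabilityMeasure μ] (n : ℕ) (q r ρ : ℝ) (hq : 2 ≤ q) (hr : 1 ≤ r)
    (f : (Fin n → Ω) → ℝ)
    (hf : ∀ (S : Finset (Fin n)) (x : {i // i ∈ S} → Ω),
      eLpNorm (restriction f S x) 2 (productMeasure μ {i // i ∉ S}) ≤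
        ENNReal.ofReal (r ^ S.card) * eLpNorm f 2 (productMeasure μ (Fin n)))
    (hρ0 : 0 ≤ ρ) (hρ : ρ ≤ Real.log q / (32 * r * q)) :
    eLpNorm (noiseOperator μ ρ f) (ENNReal.ofReal q) (productMeasure μ (Fin n)) ≤
      eLpNorm f 2 (productMeasure μ (Fin n)) := by
  have hq0 : 0 < q := by linarith
  have hL0 : 0 ≤ Real.log q := Real.log_nonneg (by linarith)
  have hρ1 : ρ ≤ 1 := by
    refine hρ.trans ?_
    rw [div_le_one (by positivity)]
    have := Real.log_le_sub_one_of_pos hq0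
    nlinarith
  -- The constant 32 comes from `1 + r ≤ 2r`.
  have hρ' : ρ ≤ Real.log q / (16 * (1 + r) * q) := by
    refine hρ.trans ?_
    apply div_le_div_of_nonneg_left hL0 (by positivity)
    apply mul_le_mul_of_nonneg_right _ hq0.le
    linarith
  set w : Ω → ℝ := fun z => μ.real {z} with hw
  have hw0 : ∀ z, 0 ≤ w z := fun z => measureReal_nonneg
  set N := ∑ x, piWeight w x * f x ^ 2 with hN
  have hN0 : 0 ≤ N := Finset.sum_nonneg fun x _ =>
    mul_nonneg (piWeight_nonneg hw0 x) (sq_nonneg _)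
  set M := √N with hM
  have hM0 : 0 ≤ M := Real.sqrt_nonneg N
  have hglob : IsGlobal w r M f := fun S x => by
    have h := hf S fun i => x i
    rw [eLpNorm_two_productMeasure, eLpNorm_two_productMeasure,
      ← ENNReal.ofReal_mul (by positivity), ENNReal.ofReal_le_ofReal_iff (by positivity),
      ← sum_piWeight_piecewise] at h
    simp only [Real.norm_eq_abs, sq_abs]
    exact Real.sqrt_le_left (by positivity) |>.mp h
  have key := sum_abs_noiseSum_rpow_le_of_isGlobal hw0 (sum_measureReal_singleton_eq_one μ)
    hq hr hρ0 hρ' hM0 hglob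
  rw [eLpNorm_productMeasure μ hq0, eLpNorm_two_productMeasure]
  apply ENNReal.ofReal_le_ofReal
  simp only [noiseOperator_eq_noiseSum μ hρ0 hρ1]
  have hle : ∑ x, piWeight w x * ‖noiseSum w ρ f x‖ ^ q ≤ M ^ q := by
    refine key.trans_eq ?_
    rw [← hN, ← Real.sq_sqrt hN0, ← Real.rpow_natCast, ← Real.rpow_add_of_nonneg hM0
      (by linarith) (by norm_num)]
    congr 1; push_cast; ring
  calc _ ≤ (M ^ q) ^ q⁻¹ := Real.rpow_le_rpow (Finset.sum_nonneg fun x _ =>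
        mul_nonneg (piWeight_nonneg hw0 x) (by positivity)) hle (by positivity)
    _ = M := Real.rpow_rpow_inv hM0 hq0.ne'
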